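/- Call a set $C\subseteq\mathbb{R}$ symmetric if there is a real number $c$ such that for all $x\in\mathbb{R}$, $c+x\in C$ if and only if $c-x\in C$. For $0<\varepsilon\le 1$ let $\Delta(\varepsilon)$ be the supremum of all real numbers $\delta$ such that every Lebesgue measurable subset of $[0,1)$ with measure $\varepsilon$ contains a (Lebesgue measurable) symmetric subset with measure $\delta$. Then the function $\Delta$ is continuous on $(0,1]$ and, in fact, satisfies the Lipschitz condition $|\Delta(x)-\Delta(y)|\le 2|x-y|$ for all $x,y\in(0,1]$. Furthermore, the function $\Delta(\varepsilon)/\varepsilon^2$ is increasing (in the weak sense, i.e. nondecreasing) on $(0,1]$, and hence $\lim_{\varepsilon\to0^+}\Delta(\varepsilon)/\varepsilon^2$ exists as a finite real number. -/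

import Mathlib

open Set Filter Topology MeasureTheory

namespace ContinuousRamsey

/-- A set `C` of reals is symmetric if there is a center `c` such that, for all `x`,
`c + x` lies in `C` if and only if `c - x` does. -/
def IsSymmetric (C : Set ℝ) : Prop :=
  ∃ c : ℝ, ∀ x : ℝ, c + x ∈ C ↔ c - x ∈ C

/-- Every Lebesgue measurable subset of `[0, 1)` with measure `ε` contains a (Lebesgue measurable)
symmetric subset with measure `δ`. Lebesgue measurability is `NullMeasurableSet` here, as
`MeasurableSet` on `ℝ` means Borel; all measures below are finite, the sets being bounded. -/
def ForcesSymmetric (ε δ : ℝ) : Prop :=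
  ∀ A : Set ℝ, A ⊆ Ico 0 1 → NullMeasurableSet A volume → volume.real A = ε →
    ∃ C : Set ℝ, C ⊆ A ∧ NullMeasurableSet C volume ∧ IsSymmetric C ∧ volume.real C = δ

/-- The supremum of all `δ` such that every measurable subset of `[0, 1)` with measure `ε`
contains a symmetric subset with measure `δ`. For `0 < ε ≤ 1` this is a supremum of a nonempty
set of reals that is bounded above (by `ε`). -/
noncomputable def Delta (ε : ℝ) : ℝ :=
  sSup {δ : ℝ | ForcesSymmetric ε δ}

end ContinuousRamsey

namespace ContinuousRamsey

/-! The largest subset of `A` symmetric about `s / 2` is `symmPart A s`, and cutting it with centred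
intervals gives every smaller measure. So `Delta ε` is the infimum over `A` of the supremum over `s`
of `corr A s` (`delta_le`, `le_delta`). Adding a set of measure `η` raises `corr` by at most `2 *
η`, whence the Lipschitz bound. For `Delta ε / ε ^ 2`, thin a set `A` of measure `y` to density `p =
x / y` so that all its correlations shrink by about `p ^ 2`. Random thinning would do this; here it
is explicit. Approximate `A` by a union of grid cells and intersect the `m`-th cell with a periodic
band of period `Q⁻¹ ^ (m + 1)`. Bands of different scales are nearly independent, even after
reflection (`measureReal_bandPair_pow_inter_Icc_le`), and a cell meets its own reflection only near
the centre (`corr_thinnedGridSet_le`). The Lipschitz bound absorbs the errors. The limit exists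
because the ratio is monotone and nonnegative. -/

/-! ### Correlations and symmetric subsets -/

/-- The part of `A` that the reflection `t ↦ s - t` keeps inside `A`. -/
def symmPart (A : Set ℝ) (s : ℝ) : Set ℝ := {t | t ∈ A ∧ s - t ∈ A}

/-- The measure of the largest subset of `A` symmetric about `s / 2`. -/
noncomputable def corr (A : Set ℝ) (s : ℝ) : ℝ := volume.real (symmPart A s)

theorem symmPart_subset (A : Set ℝ) (s : ℝ) : symmPart A s ⊆ A := fun _ h => h.1

theorem quasiMeasurePreserving_const_sub (s : ℝ) :
    Measure.QuasiMeasurePreserving (fun t : ℝ => s - t) volume volume :=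
  (Measure.measurePreserving_sub_left volume s).quasiMeasurePreserving

theorem nullMeasurableSet_symmPart {A : Set ℝ} (hA : NullMeasurableSet A volume) (s : ℝ) :
    NullMeasurableSet (symmPart A s) volume :=
  hA.inter (hA.preimage (quasiMeasurePreserving_const_sub s))

theorem measureReal_const_sub_preimage (E : Set ℝ) (hE : NullMeasurableSet E volume) (s : ℝ) :
    volume.real {t | s - t ∈ E} = volume.real E := by
  have := (Measure.measurePreserving_sub_left (volume : Measure ℝ) s).measure_preimage hE
  simp only [Measure.real]
  exact congrArg ENNReal.toReal this

theorem volume_ne_top_of_subset_Ico {A : Set ℝ} {a b : ℝ} (hA : A ⊆ Ico a b) : volume A ≠ ⊤ :=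
  ((measure_mono hA).trans_lt measure_Ico_lt_top).ne

theorem measureReal_le_of_subset_Ico {A : Set ℝ} (hA : A ⊆ Ico 0 1) : volume.real A ≤ 1 := by
  have := measureReal_mono (μ := volume) hA measure_Ico_lt_top.ne
  simpa using this

theorem corr_mono {A B : Set ℝ} (h : A ⊆ B) (hB : volume B ≠ ⊤) (s : ℝ) : corr A s ≤ corr B s :=
  measureReal_mono (fun _ ht => ⟨h ht.1, h ht.2⟩)
    ((measure_mono (symmPart_subset B s)).trans_lt hB.lt_top).ne

/-- A point of `symmPart A s` outside `symmPart B s` lies in `E` or has its reflection there; this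
is the source of the Lipschitz constant 2. -/
theorem corr_le_add {A B E : Set ℝ} (h : A ⊆ B ∪ E) (hE : NullMeasurableSet E volume)
    (hBt : volume B ≠ ⊤) (hEt : volume E ≠ ⊤) (s : ℝ) :
    corr A s ≤ corr B s + 2 * volume.real E := by
  have hEr : volume {t | s - t ∈ E} = volume E :=
    (Measure.measurePreserving_sub_left (volume : Measure ℝ) s).measure_preimage hE
  have hsub : symmPart A s ⊆ symmPart B s ∪ (E ∪ {t | s - t ∈ E}) := by
    rintro t ⟨h1, h2⟩
    rcases h h1 with h1 | h1
    · rcases h h2 with h2 | h2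
      · exact Or.inl ⟨h1, h2⟩
      · exact Or.inr (Or.inr h2)
    · exact Or.inr (Or.inl h1)
  have hBs : volume (symmPart B s) ≠ ⊤ :=
    ((measure_mono (symmPart_subset B s)).trans_lt hBt.lt_top).ne
  have h1 := measureReal_mono (μ := volume) hsub
    (measure_union_ne_top hBs (measure_union_ne_top hEt (hEr ▸ hEt)))
  have h2 := measureReal_union_le (μ := volume) (symmPart B s) (E ∪ {t | s - t ∈ E})
  have h3 := measureReal_union_le (μ := volume) E {t | s - t ∈ E}
  rw [measureReal_const_sub_preimage E hE s] at h3
  unfold corr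
  linarith

/-- Intermediate value theorem in the radius. Centred intervals are used because they preserve
symmetry about `c`. -/
theorem exists_measureReal_inter_Icc_eq {E : Set ℝ} (hE : E ⊆ Ico 0 1) (c : ℝ) {d : ℝ}
    (hd0 : 0 ≤ d) (hd : d ≤ volume.real E) :
    ∃ r, volume.real (E ∩ Icc (c - r) (c + r)) = d := by
  have hEt := volume_ne_top_of_subset_Ico hE
  have hfin : ∀ r, volume (E ∩ Icc (c - r) (c + r)) ≠ ⊤ := fun r =>
    ((measure_mono inter_subset_left).trans_lt hEt.lt_top).ne
  set f : ℝ → ℝ := fun r => volume.real (E ∩ Icc (c - r) (c + r)) with hf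
  have hmono : Monotone f := fun r r' h =>
    measureReal_mono (inter_subset_inter_right _ (Icc_subset_Icc (by linarith) (by linarith)))
      (hfin r')
  have hlip : ∀ r r', r ≤ r' → f r' ≤ f r + 2 * (r' - r) := by
    intro r r' h
    have hsub : E ∩ Icc (c - r') (c + r') ⊆
        (E ∩ Icc (c - r) (c + r)) ∪ (Icc (c - r') (c - r) ∪ Icc (c + r) (c + r')) := by
      rintro t ⟨h1, h2, h3⟩
      by_cases h4 : t < c - r
      · exact Or.inr (Or.inl ⟨h2, h4.le⟩)
      · by_cases h5 : c + r < t
        · exact Or.inr (Or.inr ⟨h5.le, h3⟩)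
        · exact Or.inl ⟨h1, not_lt.1 h4, not_lt.1 h5⟩
    have h1 := measureReal_mono (μ := volume) hsub
      (measure_union_ne_top (hfin r) (measure_union_ne_top measure_Icc_lt_top.ne
        measure_Icc_lt_top.ne))
    have h2 := measureReal_union_le (μ := volume) (E ∩ Icc (c - r) (c + r))
      (Icc (c - r') (c - r) ∪ Icc (c + r) (c + r'))
    have h3 := measureReal_union_le (μ := volume) (Icc (c - r') (c - r)) (Icc (c + r) (c + r'))
    rw [Real.volume_real_Icc_of_le (by linarith), Real.volume_real_Icc_of_le (by linarith)] at h3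
    simp only [hf]
    linarith
  have hcont : Continuous f := by
    refine (LipschitzWith.of_dist_le_mul (K := 2) fun r r' => ?_).continuous
    rw [Real.dist_eq, Real.dist_eq]
    norm_num
    rcases le_total r r' with h | h
    · rw [abs_sub_comm, abs_sub_comm r, abs_of_nonneg (sub_nonneg.2 (hmono h)),
        abs_of_nonneg (sub_nonneg.2 h)]
      linarith [hlip r r' h]
    · rw [abs_of_nonneg (sub_nonneg.2 (hmono h)), abs_of_nonneg (sub_nonneg.2 h)]
      linarith [hlip r' r h]
  have h0 : f 0 = 0 := by
    simp only [hf, sub_zero, add_zero, Icc_self]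
    exact measureReal_mono_null inter_subset_right (by simp [Measure.real]) (by simp)
  have h1 : f (|c| + 1) = volume.real E := by
    simp only [hf]
    congr 1
    refine inter_eq_left.2 fun t ht => ?_
    have := hE ht
    constructor <;> linarith [this.1, this.2, le_abs_self c, neg_abs_le c]
  have hle : (0 : ℝ) ≤ |c| + 1 := by positivity
  obtain ⟨r, -, hr⟩ := intermediate_value_Icc hle hcont.continuousOn
    (show d ∈ Icc (f 0) (f (|c| + 1)) from ⟨h0.le.trans hd0, hd.trans h1.ge⟩)
  exact ⟨r, hr⟩

theorem forcesSymmetric_zero (ε : ℝ) : ForcesSymmetric ε 0 := fun A _ _ _ =>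
  ⟨∅, empty_subset _, nullMeasurableSet_empty, ⟨0, by simp⟩, by simp⟩

theorem ForcesSymmetric.exists_le_corr {ε δ : ℝ} (h : ForcesSymmetric ε δ) {A : Set ℝ}
    (hA : A ⊆ Ico 0 1) (hAm : NullMeasurableSet A volume) (hε : volume.real A = ε) :
    ∃ s, δ ≤ corr A s := by
  obtain ⟨C, hCA, -, ⟨c, hc⟩, rfl⟩ := h A hA hAm hε
  refine ⟨2 * c, measureReal_mono (fun t ht => ⟨hCA ht, hCA ?_⟩)
    ((measure_mono (symmPart_subset A _)).trans_lt (volume_ne_top_of_subset_Ico hA).lt_top).ne⟩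
  have := (hc (t - c)).1 (by simpa using ht)
  convert this using 1
  ring

theorem bddAbove_forcesSymmetric {ε : ℝ} (h0 : 0 < ε) (h1 : ε ≤ 1) :
    BddAbove {δ : ℝ | ForcesSymmetric ε δ} := by
  refine ⟨1, fun δ hδ => ?_⟩
  obtain ⟨s, hs⟩ := ForcesSymmetric.exists_le_corr hδ (A := Ico 0 ε) (Ico_subset_Ico_right h1)
    measurableSet_Ico.nullMeasurableSet (by simp [h0.le])
  exact hs.trans (measureReal_le_of_subset_Ico
    ((symmPart_subset _ _).trans (Ico_subset_Ico_right h1)))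

theorem delta_le {A : Set ℝ} (hA : A ⊆ Ico 0 1) (hAm : NullMeasurableSet A volume) {c : ℝ}
    (hc : ∀ s, corr A s ≤ c) : Delta (volume.real A) ≤ c := by
  refine csSup_le ⟨0, forcesSymmetric_zero _⟩ fun δ hδ => ?_
  obtain ⟨s, hs⟩ := ForcesSymmetric.exists_le_corr hδ hA hAm rfl
  exact hs.trans (hc s)

theorem exists_lt_corr {A : Set ℝ} (hA : A ⊆ Ico 0 1) (hAm : NullMeasurableSet A volume) {d : ℝ}
    (hd : d < Delta (volume.real A)) : ∃ s, d < corr A s := by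
  by_contra! h
  exact absurd (delta_le hA hAm h) (not_le.2 hd)

theorem isSymmetric_symmPart_inter (A : Set ℝ) (s r : ℝ) :
    IsSymmetric (symmPart A s ∩ Icc (s / 2 - r) (s / 2 + r)) := by
  have key : ∀ x, s / 2 + x ∈ symmPart A s ∩ Icc (s / 2 - r) (s / 2 + r) →
      s / 2 - x ∈ symmPart A s ∩ Icc (s / 2 - r) (s / 2 + r) := by
    rintro x ⟨⟨h1, h2⟩, h3, h4⟩
    refine ⟨⟨?_, ?_⟩, by linarith, by linarith⟩
    · convert h2 using 1; ring
    · convert h1 using 1; ring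
  refine ⟨s / 2, fun x => ⟨key x, fun h => ?_⟩⟩
  have := key (-x) (by rwa [← sub_eq_add_neg])
  rwa [sub_neg_eq_add] at this

theorem delta_nonneg {ε : ℝ} (h0 : 0 < ε) (h1 : ε ≤ 1) : 0 ≤ Delta ε :=
  le_csSup (bddAbove_forcesSymmetric h0 h1) (forcesSymmetric_zero ε)

theorem le_delta {ε : ℝ} (h0 : 0 < ε) (h1 : ε ≤ 1) {d : ℝ}
    (h : ∀ A : Set ℝ, A ⊆ Ico 0 1 → NullMeasurableSet A volume → volume.real A = ε →
      ∃ s, d ≤ corr A s) : d ≤ Delta ε := by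
  -- A negative `d` is not the measure of any set, so it is compared with `0` instead.
  rcases lt_or_ge d 0 with hd | hd
  · exact hd.le.trans (delta_nonneg h0 h1)
  refine le_csSup (bddAbove_forcesSymmetric h0 h1) fun A hA hAm hAε => ?_
  obtain ⟨s, hs⟩ := h A hA hAm hAε
  obtain ⟨r, hr⟩ := exists_measureReal_inter_Icc_eq ((symmPart_subset A s).trans hA) (s / 2) hd hs
  exact ⟨_, inter_subset_left.trans (symmPart_subset A s),
    (nullMeasurableSet_symmPart hAm s).inter measurableSet_Icc.nullMeasurableSet,
    isSymmetric_symmPart_inter A s r, hr⟩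

theorem exists_nullMeasurable_subset_measureReal_eq {E : Set ℝ} (hE : E ⊆ Ico 0 1)
    (hEm : NullMeasurableSet E volume) {d : ℝ} (hd0 : 0 ≤ d) (hd : d ≤ volume.real E) :
    ∃ F ⊆ E, NullMeasurableSet F volume ∧ volume.real F = d := by
  obtain ⟨r, hr⟩ := exists_measureReal_inter_Icc_eq hE 0 hd0 hd
  exact ⟨_, inter_subset_left, hEm.inter measurableSet_Icc.nullMeasurableSet, hr⟩

/-! ### Monotonicity and the Lipschitz bound -/

theorem delta_mono {x y : ℝ} (hx : 0 < x) (hxy : x ≤ y) (hy : y ≤ 1) : Delta x ≤ Delta y := by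
  refine le_of_forall_lt fun d hd => ?_
  -- `le_delta` yields only a weak inequality; the gap between `d` and `d'` makes it strict.
  obtain ⟨d', hd', hd''⟩ := exists_between hd
  refine hd'.trans_le (le_delta (hx.trans_le hxy) hy fun A hA hAm hAy => ?_)
  obtain ⟨B, hBA, hBm, rfl⟩ :=
    exists_nullMeasurable_subset_measureReal_eq hA hAm hx.le (hAy ▸ hxy)
  obtain ⟨s, hs⟩ := exists_lt_corr (hBA.trans hA) hBm hd''
  exact ⟨s, hs.le.trans (corr_mono hBA (volume_ne_top_of_subset_Ico hA) s)⟩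

theorem delta_le_add {x y : ℝ} (hy : 0 < y) (hxy : y ≤ x) (hx : x ≤ 1) :
    Delta x ≤ Delta y + 2 * (x - y) := by
  rw [← sub_le_iff_le_add]
  refine le_of_forall_lt fun d hd => ?_
  obtain ⟨d', hd', hd''⟩ := exists_between hd
  refine hd'.trans_le (le_delta hy (hxy.trans hx) fun B hB hBm hBy => ?_)
  have hBt := volume_ne_top_of_subset_Ico hB
  -- There is room in `[0, 1)` to enlarge `B` to measure `x`, since `x - y ≤ 1 - y`.
  have hcompl : volume.real (Ico 0 1 \ B) = 1 - y := by
    have := measureReal_inter_add_sdiff₀ (μ := volume) (s := Ico (0 : ℝ) 1) hBm measure_Ico_lt_top.ne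
    rw [inter_eq_right.2 hB, hBy] at this
    simp at this
    linarith
  obtain ⟨E, hEs, hEm, hE⟩ := exists_nullMeasurable_subset_measureReal_eq
    (sdiff_subset : Ico 0 1 \ B ⊆ Ico (0 : ℝ) 1) (measurableSet_Ico.nullMeasurableSet.diff hBm)
    (sub_nonneg.2 hxy) (by linarith)
  have hE1 : E ⊆ Ico 0 1 := hEs.trans sdiff_subset
  have hEt := volume_ne_top_of_subset_Ico hE1
  have hA : volume.real (B ∪ E) = x := by
    rw [measureReal_union₀ hEm
      (disjoint_left.2 fun t h1 h2 => (hEs h2).2 h1).aedisjoint hBt hEt, hE, hBy]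
    ring
  obtain ⟨s, hs⟩ := exists_lt_corr (d := d' + 2 * (x - y)) (union_subset hB hE1) (hBm.union hEm)
    (by rw [hA]; linarith)
  refine ⟨s, ?_⟩
  have := corr_le_add (subset_refl (B ∪ E)) hEm hBt hEt s
  rw [hE] at this
  linarith

/-! ### Integrals of periodic functions -/

section Periodic

variable {f : ℝ → ℝ} {w : ℝ}

theorem _root_.Function.Periodic.intervalIntegral_add_nat_mul_eq (hf : Function.Periodic f w)
    (hi : ∀ a b, IntervalIntegrable f volume a b) (n : ℕ) (a : ℝ) :
    ∫ t in a..a + n * w, f t = n * ∫ t in (0 : ℝ)..w, f t := by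
  have h := hf.intervalIntegral_add_zsmul_eq n a hi
  rw [hf.intervalIntegral_add_eq a 0, zero_add] at h
  simpa using h

theorem _root_.Function.Periodic.intervalIntegral_le (hf : Function.Periodic f w) (hw : 0 < w)
    (h0 : ∀ t, 0 ≤ f t) (hi : ∀ a b, IntervalIntegrable f volume a b) {a b : ℝ} (hab : a ≤ b) :
    ∫ t in a..b, f t ≤ ((b - a) / w + 1) * ∫ t in (0 : ℝ)..w, f t := by
  have hI : 0 ≤ ∫ t in (0 : ℝ)..w, f t := intervalIntegral.integral_nonneg hw.le fun t _ => h0 t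
  have hq : 0 ≤ (b - a) / w := div_nonneg (by linarith) hw.le
  have hn : (b - a) / w < (⌊(b - a) / w⌋₊ + 1 : ℕ) := by exact_mod_cast Nat.lt_floor_add_one _
  have hb : b ≤ a + (⌊(b - a) / w⌋₊ + 1 : ℕ) * w := by
    rw [div_lt_iff₀ hw] at hn; linarith
  calc ∫ t in a..b, f t ≤ ∫ t in a..a + (⌊(b - a) / w⌋₊ + 1 : ℕ) * w, f t :=
        intervalIntegral.integral_mono_interval le_rfl hab hb
          (Eventually.of_forall fun t => h0 t) (hi _ _)
    _ = (⌊(b - a) / w⌋₊ + 1 : ℕ) * ∫ t in (0 : ℝ)..w, f t :=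
        hf.intervalIntegral_add_nat_mul_eq hi _ a
    _ ≤ _ := by
        gcongr
        push_cast
        linarith [Nat.floor_le hq]

theorem _root_.Function.Periodic.le_intervalIntegral (hf : Function.Periodic f w) (hw : 0 < w)
    (h0 : ∀ t, 0 ≤ f t) (hi : ∀ a b, IntervalIntegrable f volume a b) {a b : ℝ} (hab : a ≤ b) :
    ((b - a) / w - 1) * ∫ t in (0 : ℝ)..w, f t ≤ ∫ t in a..b, f t := by
  have hI : 0 ≤ ∫ t in (0 : ℝ)..w, f t := intervalIntegral.integral_nonneg hw.le fun t _ => h0 t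
  have hq : 0 ≤ (b - a) / w := div_nonneg (by linarith) hw.le
  have hb : a + ⌊(b - a) / w⌋₊ * w ≤ b := by
    have := Nat.floor_le hq
    rw [le_div_iff₀ hw] at this; linarith
  calc ((b - a) / w - 1) * ∫ t in (0 : ℝ)..w, f t ≤ ⌊(b - a) / w⌋₊ * ∫ t in (0 : ℝ)..w, f t := by
        gcongr
        linarith [Nat.lt_floor_add_one ((b - a) / w)]
    _ = ∫ t in a..a + ⌊(b - a) / w⌋₊ * w, f t := (hf.intervalIntegral_add_nat_mul_eq hi _ a).symm
    _ ≤ _ := intervalIntegral.integral_mono_interval le_rfl (by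
          have : 0 ≤ (⌊(b - a) / w⌋₊ : ℝ) * w := by positivity
          linarith) hb
          (Eventually.of_forall fun t => h0 t) (hi _ _)

end Periodic

/-! ### Bands and their near independence -/

/-- The `w`-periodic set of density `p` made of the initial segments of the cells
`[k * w, (k + 1) * w)`. -/
def band (p w : ℝ) : Set ℝ := {t | Int.fract (t / w) < p}

theorem measurableSet_band (p w : ℝ) : MeasurableSet (band p w) :=
  measurableSet_lt (by fun_prop) measurable_const

theorem intervalIntegrable_indicator_one {E : Set ℝ} (hE : MeasurableSet E) (a b : ℝ) :
    IntervalIntegrable (E.indicator (1 : ℝ → ℝ)) volume a b :=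
  (intervalIntegrable_const (c := (1 : ℝ))).mono_fun
    ((measurable_one.indicator hE).aestronglyMeasurable)
    (Eventually.of_forall fun t => by by_cases h : t ∈ E <;> simp [h])

theorem intervalIntegral_indicator_one {E : Set ℝ} (hE : MeasurableSet E) {a b : ℝ}
    (hab : a ≤ b) : ∫ t in a..b, E.indicator (1 : ℝ → ℝ) t = volume.real (E ∩ Icc a b) := by
  rw [intervalIntegral.integral_of_le hab, ← integral_Icc_eq_integral_Ioc,
    integral_indicator_one hE, measureReal_restrict_apply hE]

theorem indicator_one_nonneg (E : Set ℝ) (t : ℝ) : 0 ≤ E.indicator (1 : ℝ → ℝ) t :=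
  indicator_nonneg (fun _ _ => zero_le_one) t

theorem add_mem_band_iff {p w t : ℝ} (hw : 0 < w) (n : ℤ) :
    t + n * w ∈ band p w ↔ t ∈ band p w := by
  have : (t + n * w) / w = t / w + n := by field_simp
  simp [band, this]

theorem mem_band_iff_of_mem_Ico {p w t : ℝ} (hw : 0 < w) (ht : t ∈ Ico 0 w) :
    t ∈ band p w ↔ t < p * w := by
  have : Int.fract (t / w) = t / w :=
    Int.fract_eq_self.2 ⟨div_nonneg ht.1 hw.le, (div_lt_one hw).2 ht.2⟩
  simp [band, this, div_lt_iff₀ hw]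

theorem measureReal_band_inter_inter_Icc_le {p w : ℝ} (hw : 0 < w) (E : Set ℝ) :
    volume.real ((band p w ∩ E) ∩ Icc 0 w) ≤ volume.real (E ∩ Icc 0 (p * w)) := by
  -- The endpoint `w` already starts the next cell, so it may lie in the band; it is a null set.
  have hsub : (band p w ∩ E) ∩ Icc 0 w ⊆ (E ∩ Icc 0 (p * w)) ∪ {w} := by
    rintro t ⟨⟨h1, h2⟩, h3, h4⟩
    rcases h4.eq_or_lt with h4 | h4
    · exact Or.inr h4
    · exact Or.inl ⟨h2, h3, ((mem_band_iff_of_mem_Ico hw ⟨h3, h4⟩).1 h1).le⟩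
  have hfin : volume (E ∩ Icc 0 (p * w)) ≠ ⊤ :=
    ((measure_mono inter_subset_right).trans_lt measure_Icc_lt_top).ne
  have h1 := measureReal_mono (μ := volume) hsub (measure_union_ne_top hfin (by simp))
  have h2 := measureReal_union_le (μ := volume) (E ∩ Icc 0 (p * w)) {w}
  have h3 : volume.real {w} = 0 := by simp [Measure.real]
  linarith

theorem measureReal_band_inter_Icc {p w : ℝ} (hw : 0 < w) (hp0 : 0 ≤ p) (hp1 : p ≤ 1) :
    volume.real (band p w ∩ Icc 0 w) = p * w := by
  have hpw : p * w ≤ w := mul_le_of_le_one_left hw.le hp1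
  have hpw0 : 0 ≤ p * w := by positivity
  apply le_antisymm
  · simpa [Real.volume_real_Icc_of_le hpw0] using
      measureReal_band_inter_inter_Icc_le (p := p) hw univ
  · have hsub : Ico 0 (p * w) ⊆ band p w ∩ Icc 0 w := fun t ht =>
      ⟨(mem_band_iff_of_mem_Ico hw ⟨ht.1, ht.2.trans_le hpw⟩).2 ht.2, ht.1,
        (ht.2.trans_le hpw).le⟩
    have := measureReal_mono (μ := volume) hsub
      ((measure_mono inter_subset_right).trans_lt measure_Icc_lt_top).ne
    rwa [Real.volume_real_Ico_of_le hpw0, sub_zero] at this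

theorem periodic_indicator_band {p w : ℝ} (hw : 0 < w) :
    Function.Periodic ((band p w).indicator (1 : ℝ → ℝ)) w := fun t => by
  have h := add_mem_band_iff (p := p) (t := t) hw 1
  simp only [Int.cast_one, one_mul] at h
  by_cases ht : t ∈ band p w
  · simp [ht, h.2 ht]
  · simp [ht, mt h.1 ht]

theorem measureReal_band_inter_Icc_le {p w a b : ℝ} (hw : 0 < w) (hp0 : 0 ≤ p) (hp1 : p ≤ 1)
    (hab : a ≤ b) : volume.real (band p w ∩ Icc a b) ≤ p * (b - a) + p * w := by
  have := (periodic_indicator_band (p := p) hw).intervalIntegral_le hw (indicator_one_nonneg _)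
    (intervalIntegrable_indicator_one (measurableSet_band p w)) hab
  rw [intervalIntegral_indicator_one (measurableSet_band p w) hab,
    intervalIntegral_indicator_one (measurableSet_band p w) hw.le,
    measureReal_band_inter_Icc hw hp0 hp1] at this
  convert this using 1
  field_simp

theorem le_measureReal_band_inter_Icc {p w a b : ℝ} (hw : 0 < w) (hp0 : 0 ≤ p) (hp1 : p ≤ 1)
    (hab : a ≤ b) : p * (b - a) - p * w ≤ volume.real (band p w ∩ Icc a b) := by
  have := (periodic_indicator_band (p := p) hw).le_intervalIntegral hw (indicator_one_nonneg _)
    (intervalIntegrable_indicator_one (measurableSet_band p w)) hab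
  rw [intervalIntegral_indicator_one (measurableSet_band p w) hab,
    intervalIntegral_indicator_one (measurableSet_band p w) hw.le,
    measureReal_band_inter_Icc hw hp0 hp1] at this
  convert this using 1
  field_simp

/-- The points of one band whose reflection lies in another. -/
def bandPair (p w w' s : ℝ) : Set ℝ := band p w ∩ {t | s - t ∈ band p w'}

theorem measurableSet_bandPair (p w w' s : ℝ) : MeasurableSet (bandPair p w w' s) :=
  (measurableSet_band p w).inter ((measurableSet_band p w').preimage (measurable_const_sub s))

theorem measureReal_const_sub_inter_Icc {E : Set ℝ} (hE : MeasurableSet E) (s a b : ℝ) :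
    volume.real ({t | s - t ∈ E} ∩ Icc a b) = volume.real (E ∩ Icc (s - b) (s - a)) := by
  rw [← measureReal_const_sub_preimage (E ∩ Icc (s - b) (s - a))
    (hE.inter measurableSet_Icc).nullMeasurableSet s]
  congr 1
  ext t
  simp only [mem_inter_iff, mem_ofPred_eq, mem_Icc, sub_le_sub_iff_left]
  tauto

theorem measureReal_bandPair_inter_Icc_comm (p w w' s a b : ℝ) :
    volume.real (bandPair p w w' s ∩ Icc a b) =
      volume.real (bandPair p w' w s ∩ Icc (s - b) (s - a)) := by
  rw [← measureReal_const_sub_inter_Icc (measurableSet_bandPair p w' w s)]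
  congr 2
  ext t
  simp [bandPair, and_comm]

theorem periodic_indicator_bandPair {p w w' s : ℝ} (hw' : 0 < w') (n : ℕ) (hw0 : 0 < w)
    (hw : w = n * w') : Function.Periodic ((bandPair p w w' s).indicator (1 : ℝ → ℝ)) w := by
  intro t
  have h := add_mem_band_iff (p := p) (t := t) hw0 1
  have h' := add_mem_band_iff (p := p) (t := s - t) hw' (-n)
  simp only [Int.cast_one, one_mul] at h
  have e : s - t + ((-n : ℤ) : ℝ) * w' = s - (t + w) := by rw [hw]; push_cast; ring
  rw [e] at h'
  have : t + w ∈ bandPair p w w' s ↔ t ∈ bandPair p w w' s := and_congr h h'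
  by_cases ht : t ∈ bandPair p w w' s
  · simp [ht, this.2 ht]
  · simp [ht, mt this.1 ht]

/-- In one coarse period the coarse band is an interval of length `p * w`, on whose reflection the
fine band has density `p` up to one fine period: at most `p ^ 2 * w + w'` in all. At most `(b - a) /
w + 1` periods are needed. -/
theorem measureReal_bandPair_inter_Icc_le {p w w' s a b : ℝ} (hw' : 0 < w') (n : ℕ) (hw0 : 0 < w)
    (hw : w = n * w') (hp0 : 0 ≤ p) (hp1 : p ≤ 1) (hab : a ≤ b) :
    volume.real (bandPair p w w' s ∩ Icc a b) ≤
      p ^ 2 * (b - a) + (b - a) * (w' / w) + w + w' := by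
  have hm := measurableSet_bandPair p w w' s
  have h := (periodic_indicator_bandPair (p := p) (s := s) hw' n hw0 hw).intervalIntegral_le hw0
    (indicator_one_nonneg _) (intervalIntegrable_indicator_one hm) hab
  rw [intervalIntegral_indicator_one hm hab, intervalIntegral_indicator_one hm hw0.le] at h
  have hpw0 : 0 ≤ p * w := by positivity
  have h1 : volume.real (bandPair p w w' s ∩ Icc 0 w) ≤ p ^ 2 * w + w' := by
    refine (measureReal_band_inter_inter_Icc_le hw0 _).trans ?_
    rw [measureReal_const_sub_inter_Icc (measurableSet_band p w')]
    refine (measureReal_band_inter_Icc_le hw' hp0 hp1 (by linarith)).trans ?_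
    nlinarith
  have hq : 0 ≤ (b - a) / w + 1 := by
    have := div_nonneg (sub_nonneg.2 hab) hw0.le
    linarith
  refine (h.trans (mul_le_mul_of_nonneg_left h1 hq)).trans ?_
  have e : ((b - a) / w + 1) * (p ^ 2 * w + w') =
      p ^ 2 * (b - a) + (b - a) * (w' / w) + p ^ 2 * w + w' := by
    field_simp
    ring
  have : p ^ 2 ≤ 1 := pow_le_one₀ hp0 hp1
  nlinarith

theorem measureReal_bandPair_pow_inter_Icc_le {p s a b : ℝ} {Q m l : ℕ} (hQ : 0 < Q) (hml : m ≠ l)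
    (hp0 : 0 ≤ p) (hp1 : p ≤ 1) (hab : a ≤ b) (hba : b - a ≤ 1) :
    volume.real (bandPair p ((Q : ℝ)⁻¹ ^ (m + 1)) ((Q : ℝ)⁻¹ ^ (l + 1)) s ∩ Icc a b) ≤
      p ^ 2 * (b - a) + 3 / Q := by
  -- Reflection swaps the two bands, so the first may be taken to be the coarser.
  wlog hlt : m < l generalizing m l a b
  · rw [measureReal_bandPair_inter_Icc_comm]
    have := this (a := s - b) (b := s - a) hml.symm (by linarith) (by linarith) (by omega)
    simpa using this
  obtain ⟨k, rfl⟩ := Nat.exists_eq_add_of_lt hlt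
  have hQ0 : (0 : ℝ) < (Q : ℝ)⁻¹ := by positivity
  have hQ1 : (Q : ℝ)⁻¹ ≤ 1 := inv_le_one_of_one_le₀ (by exact_mod_cast hQ)
  have hp : ∀ j : ℕ, (Q : ℝ)⁻¹ ^ (j + 1) ≤ (Q : ℝ)⁻¹ := fun j =>
    pow_le_of_le_one hQ0.le hQ1 (by omega)
  have e : (Q : ℝ)⁻¹ ^ (m + k + 1 + 1) = (Q : ℝ)⁻¹ ^ (m + 1) * (Q : ℝ)⁻¹ ^ (k + 1) := by ring
  have h := measureReal_bandPair_inter_Icc_le (p := p) (s := s) (w := (Q : ℝ)⁻¹ ^ (m + 1))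
    (w' := (Q : ℝ)⁻¹ ^ (m + k + 1 + 1)) (by positivity) (Q ^ (k + 1)) (by positivity)
    (by rw [e, mul_left_comm]; push_cast; rw [← mul_pow, mul_inv_cancel₀ (by positivity)]; simp)
    hp0 hp1 hab
  have e2 : (Q : ℝ)⁻¹ ^ (m + k + 1 + 1) / (Q : ℝ)⁻¹ ^ (m + 1) = (Q : ℝ)⁻¹ ^ (k + 1) := by
    rw [e, mul_div_cancel_left₀ _ (by positivity)]
  rw [e2] at h
  have h1 := hp k
  have h2 : (b - a) * (Q : ℝ)⁻¹ ^ (k + 1) ≤ (Q : ℝ)⁻¹ :=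
    (mul_le_of_le_one_left (by positivity) hba).trans h1
  have h3 := hp m
  have h4 := hp (m + k + 1)
  rw [div_eq_mul_inv]
  -- Each of the three error terms, `(b - a) * (w' / w)`, `w` and `w'`, is at most `1 / Q`.
  linarith

/-! ### Thinning a union of grid cells -/

/-- The `m`-th interval of the grid of mesh `1 / M`. -/
def gridCell (M m : ℕ) : Set ℝ := Ico (m / M : ℝ) ((m + 1) / M)

theorem gridCell_eq_of_mem {M m l : ℕ} (hM : 0 < M) {t : ℝ} (hm : t ∈ gridCell M m)
    (hl : t ∈ gridCell M l) : m = l := by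
  have hM' : (0 : ℝ) < M := by exact_mod_cast hM
  have h1 := (div_lt_div_iff_of_pos_right hM').1 (hm.1.trans_lt hl.2)
  have h2 := (div_lt_div_iff_of_pos_right hM').1 (hl.1.trans_lt hm.2)
  norm_cast at h1 h2
  omega

theorem mem_gridCell_floor {M : ℕ} (hM : 0 < M) {t : ℝ} (ht : 0 ≤ t) :
    t ∈ gridCell M ⌊M * t⌋₊ := by
  have hM' : (0 : ℝ) < M := by exact_mod_cast hM
  refine ⟨?_, ?_⟩
  · rw [div_le_iff₀' hM']
    exact Nat.floor_le (by positivity)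
  · rw [lt_div_iff₀' hM']
    exact Nat.lt_floor_add_one _

theorem abs_sub_lt_of_mem_gridCell {M m : ℕ} {t u : ℝ} (ht : t ∈ gridCell M m)
    (hu : u ∈ gridCell M m) : |t - u| < 1 / M := by
  have e : ((m : ℝ) + 1) / M = m / M + 1 / M := by ring
  have h1 := ht.2
  have h2 := hu.2
  rw [e] at h1 h2
  exact abs_lt.2 ⟨by linarith [ht.1], by linarith [hu.1]⟩

theorem measurableSet_gridCell (M m : ℕ) : MeasurableSet (gridCell M m) := measurableSet_Ico

theorem measureReal_gridCell (M m : ℕ) : volume.real (gridCell M m) = 1 / M := by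
  rw [gridCell, Real.volume_real_Ico_of_le (by gcongr; linarith)]
  ring

/-- The union of the grid cells indexed by `S`. -/
def gridSet (M : ℕ) (S : Finset ℕ) : Set ℝ := ⋃ m ∈ S, gridCell M m

theorem gridSet_subset_Ico {M : ℕ} {S : Finset ℕ} (hM : 0 < M) (hS : S ⊆ Finset.range M) :
    gridSet M S ⊆ Ico 0 1 := by
  have hM' : (0 : ℝ) < M := by exact_mod_cast hM
  refine iUnion₂_subset fun m hm => Ico_subset_Ico (by positivity) ?_
  rw [div_le_one hM']
  exact_mod_cast Finset.mem_range.1 (hS hm)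

/-- The grid set `gridSet M S` thinned out by the factor `p`, at a different scale in each cell. -/
def thinnedGridSet (p : ℝ) (Q M : ℕ) (S : Finset ℕ) : Set ℝ :=
  ⋃ m ∈ S, gridCell M m ∩ band p ((Q : ℝ)⁻¹ ^ (m + 1))

theorem thinnedGridSet_subset (p : ℝ) (Q M : ℕ) (S : Finset ℕ) :
    thinnedGridSet p Q M S ⊆ gridSet M S :=
  iUnion₂_mono fun _ _ => inter_subset_left

theorem measurableSet_thinnedGridSet (p : ℝ) (Q M : ℕ) (S : Finset ℕ) :
    MeasurableSet (thinnedGridSet p Q M S) :=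
  Finset.measurableSet_biUnion S fun m _ => (measurableSet_gridCell M m).inter
    (measurableSet_band _ _)

theorem measureReal_biUnion_gridCell_inter {M : ℕ} (hM : 0 < M) (S : Finset ℕ)
    {E : ℕ → Set ℝ} (hE : ∀ m, MeasurableSet (E m)) :
    volume.real (⋃ m ∈ S, gridCell M m ∩ E m) = ∑ m ∈ S, volume.real (gridCell M m ∩ E m) := by
  refine measureReal_biUnion_finset (fun m _ l _ hml => disjoint_left.2 fun t h1 h2 =>
    hml (gridCell_eq_of_mem hM h1.1 h2.1)) (fun m _ => (measurableSet_gridCell M m).inter (hE m))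
    fun m _ => ((measure_mono inter_subset_left).trans_lt measure_Ico_lt_top).ne

theorem measureReal_gridSet {M : ℕ} (hM : 0 < M) (S : Finset ℕ) :
    volume.real (gridSet M S) = S.card * (1 / M) := by
  have := measureReal_biUnion_gridCell_inter hM S (E := fun _ => univ) fun _ => MeasurableSet.univ
  simpa [inter_univ, measureReal_gridCell, gridSet] using this

/-- Each cell falls short of density `p` by at most one band period, hence by at most `1 / Q`. -/
theorem le_measureReal_thinnedGridSet {p : ℝ} {Q M : ℕ} {S : Finset ℕ} (hp0 : 0 ≤ p) (hp1 : p ≤ 1)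
    (hQ : 0 < Q) (hM : 0 < M) :
    p * volume.real (gridSet M S) - S.card / Q ≤ volume.real (thinnedGridSet p Q M S) := by
  rw [thinnedGridSet, measureReal_biUnion_gridCell_inter hM S fun m => measurableSet_band _ _,
    measureReal_gridSet hM]
  have hQ0 : (0 : ℝ) < (Q : ℝ)⁻¹ := by positivity
  have hQ1 : (Q : ℝ)⁻¹ ≤ 1 := inv_le_one_of_one_le₀ (by exact_mod_cast hQ)
  have key : ∀ m ∈ S, p * (1 / M) - (Q : ℝ)⁻¹ ≤
      volume.real (gridCell M m ∩ band p ((Q : ℝ)⁻¹ ^ (m + 1))) := by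
    intro m _
    have hw : (Q : ℝ)⁻¹ ^ (m + 1) ≤ (Q : ℝ)⁻¹ := pow_le_of_le_one hQ0.le hQ1 (by omega)
    have hw0 : 0 < (Q : ℝ)⁻¹ ^ (m + 1) := by positivity
    have h := le_measureReal_band_inter_Icc (a := (m / M : ℝ)) (b := (m + 1) / M) hw0
      hp0 hp1 (by gcongr; linarith)
    have e : volume.real (gridCell M m ∩ band p ((Q : ℝ)⁻¹ ^ (m + 1))) =
        volume.real (band p ((Q : ℝ)⁻¹ ^ (m + 1)) ∩ Icc (m / M : ℝ) ((m + 1) / M)) := by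
      rw [inter_comm]
      exact measureReal_congr ((ae_eq_refl _).inter Ico_ae_eq_Icc)
    rw [e]
    have e2 : ((m : ℝ) + 1) / M - m / M = 1 / M := by ring
    rw [e2] at h
    nlinarith
  calc p * (S.card * (1 / M)) - S.card / Q = ∑ m ∈ S, (p * (1 / M) - (Q : ℝ)⁻¹) := by
        rw [Finset.sum_const, nsmul_eq_mul]; ring
    _ ≤ _ := Finset.sum_le_sum key

/-- The points of one grid cell whose reflection lies in another. -/
def gridCellPair (M m l : ℕ) (s : ℝ) : Set ℝ := gridCell M m ∩ {t | s - t ∈ gridCell M l}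

theorem measurableSet_gridCellPair (M m l : ℕ) (s : ℝ) : MeasurableSet (gridCellPair M m l s) :=
  (measurableSet_gridCell M m).inter
    ((measurableSet_gridCell M l).preimage (measurable_const_sub s))

theorem gridCellPair_ne_top (M m l : ℕ) (s : ℝ) : volume (gridCellPair M m l s) ≠ ⊤ :=
  ((measure_mono inter_subset_left).trans_lt measure_Ico_lt_top).ne

theorem measureReal_gridCellPair_inter_bandPair_le {p s : ℝ} {Q M m l : ℕ} (hQ : 0 < Q)
    (hM : 0 < M) (hml : m ≠ l) (hp0 : 0 ≤ p) (hp1 : p ≤ 1) :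
    volume.real (gridCellPair M m l s ∩
      bandPair p ((Q : ℝ)⁻¹ ^ (m + 1)) ((Q : ℝ)⁻¹ ^ (l + 1)) s) ≤
      p ^ 2 * volume.real (gridCellPair M m l s) + 3 / Q := by
  -- Up to endpoints the pair is the interval from `a` to `b`, so the band estimate applies to it.
  set a : ℝ := max (m / M) (s - (l + 1) / M) with ha
  set b : ℝ := min ((m + 1) / M) (s - l / M) with hb
  have hsub : gridCellPair M m l s ⊆ Icc a b := by
    rintro t ⟨⟨h1, h2⟩, h3, h4⟩
    exact ⟨max_le h1 (by linarith), le_min h2.le (by linarith)⟩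
  have hsup : Ioo a b ⊆ gridCellPair M m l s := by
    rintro t ⟨h1, h2⟩
    obtain ⟨h1, h1'⟩ := max_lt_iff.1 h1
    obtain ⟨h2, h2'⟩ := lt_min_iff.1 h2
    exact ⟨⟨h1.le, h2⟩, ⟨by linarith, by linarith⟩⟩
  rcases lt_or_ge b a with hba | hab
  · have : gridCellPair M m l s = ∅ := subset_empty_iff.1 (hsub.trans (Icc_eq_empty hba.not_ge).le)
    rw [this]
    simp only [empty_inter, measureReal_empty, mul_zero, zero_add]
    positivity
  · have hM1 : (1 : ℝ) / M ≤ 1 := div_le_one_of_le₀ (by exact_mod_cast hM) (by positivity)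
    have e : ((m : ℝ) + 1) / M = m / M + 1 / M := by ring
    have hlen : b - a ≤ 1 := by
      have h1 : (m : ℝ) / M ≤ a := le_max_left _ _
      have h2 : b ≤ ((m : ℝ) + 1) / M := min_le_left _ _
      linarith
    have h1 := measureReal_mono (μ := volume) hsup (gridCellPair_ne_top M m l s)
    rw [Real.volume_real_Ioo_of_le hab] at h1
    have h2 := measureReal_bandPair_pow_inter_Icc_le (s := s) hQ hml hp0 hp1 hab hlen
    have h3 : volume.real (gridCellPair M m l s ∩
        bandPair p ((Q : ℝ)⁻¹ ^ (m + 1)) ((Q : ℝ)⁻¹ ^ (l + 1)) s) ≤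
        volume.real (bandPair p ((Q : ℝ)⁻¹ ^ (m + 1)) ((Q : ℝ)⁻¹ ^ (l + 1)) s ∩ Icc a b) :=
      measureReal_mono (fun t ht => ⟨ht.2, hsub ht.1⟩)
        ((measure_mono inter_subset_right).trans_lt measure_Icc_lt_top).ne
    have h4 : p ^ 2 * (b - a) ≤ p ^ 2 * volume.real (gridCellPair M m l s) := by gcongr
    linarith

theorem sum_measureReal_gridCellPair_le {M : ℕ} (hM : 0 < M) {S : Finset ℕ}
    (hS : S ⊆ Finset.range M) (s : ℝ) :
    ∑ q ∈ S.offDiag, volume.real (gridCellPair M q.1 q.2 s) ≤ corr (gridSet M S) s := by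
  rw [← measureReal_biUnion_finset (fun q _ r _ hqr => disjoint_left.2 fun t h1 h2 =>
    hqr (Prod.ext (gridCell_eq_of_mem hM h1.1 h2.1) (gridCell_eq_of_mem hM h1.2 h2.2)))
    (fun q _ => measurableSet_gridCellPair M q.1 q.2 s) (fun q _ => gridCellPair_ne_top _ _ _ _)]
  refine measureReal_mono (iUnion₂_subset fun q hq t ht => ?_)
    (volume_ne_top_of_subset_Ico ((symmPart_subset _ s).trans (gridSet_subset_Ico hM hS)))
  obtain ⟨h1, h2, -⟩ := Finset.mem_offDiag.1 hq
  exact ⟨mem_iUnion₂.2 ⟨_, h1, ht.1⟩, mem_iUnion₂.2 ⟨_, h2, ht.2⟩⟩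

/-- Pairs of distinct cells cost `3 / Q` each, and there are at most `M ^ 2`. For equal cells the
scales agree and independence fails, but `t` and `s - t` are then within `1 / M`, so all these `t`
lie in the single interval `D` of length `1 / M`. -/
theorem corr_thinnedGridSet_le {p : ℝ} {Q M : ℕ} {S : Finset ℕ} (hp0 : 0 ≤ p) (hp1 : p ≤ 1)
    (hQ : 0 < Q) (hM : 0 < M) (hS : S ⊆ Finset.range M) (s : ℝ) :
    corr (thinnedGridSet p Q M S) s ≤
      p ^ 2 * corr (gridSet M S) s + 1 / M + M ^ 2 * (3 / Q) := by
  set F : ℕ × ℕ → Set ℝ := fun q => gridCellPair M q.1 q.2 s ∩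
      bandPair p ((Q : ℝ)⁻¹ ^ (q.1 + 1)) ((Q : ℝ)⁻¹ ^ (q.2 + 1)) s with hF
  set D : Set ℝ := Icc (s / 2 - 1 / M / 2) (s / 2 + 1 / M / 2) with hD
  have hsub : symmPart (thinnedGridSet p Q M S) s ⊆ D ∪ ⋃ q ∈ S.offDiag, F q := by
    rintro t ⟨h1, h2⟩
    obtain ⟨m, hm, h1, h1'⟩ := mem_iUnion₂.1 h1
    obtain ⟨l, hl, h2, h2'⟩ := mem_iUnion₂.1 h2
    by_cases hml : m = l
    · subst hml
      left
      have := abs_lt.1 (abs_sub_lt_of_mem_gridCell h1 h2)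
      constructor <;> linarith [this.1, this.2]
    · exact Or.inr (mem_iUnion₂.2 ⟨(m, l), Finset.mem_offDiag.2 ⟨hm, hl, hml⟩,
        ⟨h1, h2⟩, h1', h2'⟩)
  have hFfin : volume (⋃ q ∈ S.offDiag, F q) ≠ ⊤ := by
    refine ((measure_biUnion_finset_le _ _).trans_lt (ENNReal.sum_lt_top.2 fun q _ => ?_)).ne
    exact (measure_mono inter_subset_left).trans_lt (gridCellPair_ne_top _ _ _ _).lt_top
  have h1 := measureReal_mono (μ := volume) hsub
    (measure_union_ne_top measure_Icc_lt_top.ne hFfin)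
  have h2 := measureReal_union_le (μ := volume) D (⋃ q ∈ S.offDiag, F q)
  have h3 : volume.real D = 1 / M := by
    rw [hD, Real.volume_real_Icc_of_le (by
      have : (0 : ℝ) ≤ 1 / M / 2 := by positivity
      linarith)]
    ring
  have h4 : volume.real (⋃ q ∈ S.offDiag, F q) ≤
      ∑ q ∈ S.offDiag, (p ^ 2 * volume.real (gridCellPair M q.1 q.2 s) + 3 / Q) :=
    (measureReal_biUnion_finset_le _ _).trans (Finset.sum_le_sum fun q hq =>
      measureReal_gridCellPair_inter_bandPair_le hQ hM (Finset.mem_offDiag.1 hq).2.2 hp0 hp1)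
  rw [Finset.sum_add_distrib, ← Finset.mul_sum, Finset.sum_const, nsmul_eq_mul] at h4
  have h5 : p ^ 2 * ∑ q ∈ S.offDiag, volume.real (gridCellPair M q.1 q.2 s) ≤
      p ^ 2 * corr (gridSet M S) s := by
    gcongr
    exact sum_measureReal_gridCellPair_le hM hS s
  have h6 : (S.offDiag.card : ℝ) ≤ M ^ 2 := by
    have hc : S.card ≤ M := by simpa using Finset.card_le_card hS
    have : S.offDiag.card ≤ M ^ 2 := by
      rw [Finset.offDiag_card, sq]
      exact (Nat.sub_le _ _).trans (Nat.mul_le_mul hc hc)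
    exact_mod_cast this
  have h7 : (S.offDiag.card : ℝ) * (3 / Q) ≤ M ^ 2 * (3 / Q) := by gcongr
  unfold corr at *
  linarith

/-- With `M` fixed, `Q` beyond `3 * M ^ 2 / η` brings both `Q`-dependent errors below `η`. -/
theorem exists_thinned_subset {M : ℕ} (hM : 0 < M) {S : Finset ℕ} (hS : S ⊆ Finset.range M)
    {p η : ℝ} (hp0 : 0 ≤ p) (hp1 : p ≤ 1) (hη : 0 < η) :
    ∃ B ⊆ gridSet M S, MeasurableSet B ∧ p * volume.real (gridSet M S) - η ≤ volume.real B ∧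
      ∀ s, corr B s ≤ p ^ 2 * corr (gridSet M S) s + 1 / M + η := by
  obtain ⟨Q, hQ⟩ := exists_nat_gt (M ^ 2 * 3 / η : ℝ)
  have hM' : (1 : ℝ) ≤ M := by exact_mod_cast hM
  have hQ0 : (0 : ℝ) < Q := lt_of_le_of_lt (by positivity) hQ
  have hQ1 : 0 < Q := by exact_mod_cast hQ0
  have hsmall : (M : ℝ) ^ 2 * (3 / Q) ≤ η := by
    rw [div_lt_iff₀ hη] at hQ
    rw [← mul_div_assoc, div_le_iff₀ hQ0]
    linarith
  have hc : (S.card : ℝ) ≤ M := by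
    have : S.card ≤ M := by simpa using Finset.card_le_card hS
    exact_mod_cast this
  have hcard : (S.card : ℝ) / Q ≤ η := by
    refine le_trans ?_ hsmall
    rw [← mul_div_assoc]
    gcongr
    nlinarith
  refine ⟨thinnedGridSet p Q M S, thinnedGridSet_subset p Q M S,
    measurableSet_thinnedGridSet p Q M S, ?_, fun s => ?_⟩
  · linarith [le_measureReal_thinnedGridSet (S := S) hp0 hp1 hQ1 hM]
  · linarith [corr_thinnedGridSet_le hp0 hp1 hQ1 hM hS s]

/-! ### Approximation and scaling -/

/-- Squeeze a measurable core `A₀` between a compact `K` and an open `U`. The cells meeting `K`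
cover it and, for a mesh below the distance `δ`, stay in `U`; then `E = U \ A₀`. -/
theorem exists_gridSet_approx {A : Set ℝ} (hA : A ⊆ Ico 0 1) (hAm : NullMeasurableSet A volume)
    {η : ℝ} (hη : 0 < η) :
    ∃ M : ℕ, 0 < M ∧ (1 : ℝ) / M ≤ η ∧ ∃ S ⊆ Finset.range M,
      volume.real A - η ≤ volume.real (gridSet M S) ∧
      ∃ E, MeasurableSet E ∧ volume E ≠ ⊤ ∧ volume.real E ≤ η ∧ gridSet M S ⊆ A ∪ E := by
  classical
  obtain ⟨A₀, hA₀, hA₀m, hae⟩ := hAm.exists_measurable_subset_ae_eq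
  have hA₀t := volume_ne_top_of_subset_Ico (hA₀.trans hA)
  have hη' : ENNReal.ofReal η ≠ 0 := by simpa using hη
  obtain ⟨K, hKA, hK, hKlt⟩ := hA₀m.exists_isCompact_lt_add hA₀t hη'
  obtain ⟨U, hAU, hU, -, hUlt⟩ := hA₀m.exists_isOpen_sdiff_lt hA₀t hη'
  obtain ⟨δ, hδ, hKU⟩ := hK.exists_thickening_subset_open hU (hKA.trans hAU)
  obtain ⟨n, hn⟩ := exists_nat_one_div_lt (lt_min hδ hη)
  set M := n + 1 with hMdef
  have hM : 0 < M := Nat.succ_pos n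
  have hM' : (0 : ℝ) < M := by exact_mod_cast hM
  have hn : (1 : ℝ) / M < min δ η := by rw [hMdef]; exact_mod_cast hn
  obtain ⟨hnδ, hnη⟩ := lt_min_iff.1 hn
  refine ⟨M, hM, hnη.le, {m ∈ Finset.range M | (gridCell M m ∩ K).Nonempty},
    Finset.filter_subset _ _, ?_, U \ A₀, hU.measurableSet.diff hA₀m, ?_, ?_, ?_⟩
  · have hsub : K ⊆ gridSet M {m ∈ Finset.range M | (gridCell M m ∩ K).Nonempty} := by
      intro t ht
      have ht01 := hA (hA₀ (hKA ht))
      have hcell := mem_gridCell_floor hM ht01.1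
      refine mem_iUnion₂.2 ⟨_, Finset.mem_filter.2 ⟨Finset.mem_range.2 ?_, t, hcell, ht⟩, hcell⟩
      rw [Nat.floor_lt (by have := ht01.1; positivity)]
      nlinarith [ht01.2]
    have h1 := measureReal_mono (μ := volume) hsub (volume_ne_top_of_subset_Ico
      (gridSet_subset_Ico hM (Finset.filter_subset _ _)))
    have hKt := volume_ne_top_of_subset_Ico ((hKA.trans hA₀).trans hA)
    have h2 : volume.real A₀ ≤ volume.real K + η := by
      have := ENNReal.toReal_mono (ENNReal.add_ne_top.2 ⟨hKt, ENNReal.ofReal_ne_top⟩) hKlt.le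
      rwa [ENNReal.toReal_add hKt ENNReal.ofReal_ne_top, ENNReal.toReal_ofReal hη.le] at this
    rw [← measureReal_congr hae]
    linarith
  · exact (hUlt.trans ENNReal.ofReal_lt_top).ne
  · have := ENNReal.toReal_mono ENNReal.ofReal_ne_top hUlt.le
    rwa [ENNReal.toReal_ofReal hη.le] at this
  · refine iUnion₂_subset fun m hm t ht => ?_
    obtain ⟨-, u, hu, huK⟩ := Finset.mem_filter.1 hm
    by_cases htA : t ∈ A₀
    · exact Or.inl (hA₀ htA)
    · refine Or.inr ⟨hKU (Metric.mem_thickening_iff.2 ⟨u, huK, ?_⟩), htA⟩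
      rw [Real.dist_eq]
      exact (abs_sub_lt_of_mem_gridCell ht hu).trans hnδ

theorem delta_le_mul_of_forall_corr_le {p x : ℝ} (hp0 : 0 < p) (hp1 : p ≤ 1) {A : Set ℝ}
    (hA : A ⊆ Ico 0 1) (hAm : NullMeasurableSet A volume) (hx : 0 < x)
    (hxA : x = p * volume.real A) {d : ℝ} (hd : ∀ s, corr A s ≤ d) : Delta x ≤ p ^ 2 * d := by
  -- Of the `8 * η`, half is the excess of the correlations of `B` over `p ^ 2 * d`; the other half
  -- is the Lipschitz cost of `B` having measure possibly as small as `x - 2 * η`.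
  refine le_of_forall_pos_le_add fun γ hγ => ?_
  obtain ⟨η, hη, hηγ, hηx⟩ : ∃ η : ℝ, 0 < η ∧ 8 * η ≤ γ ∧ 2 * η < x :=
    ⟨min (γ / 8) (x / 3), lt_min (by linarith) (by linarith),
      by linarith [min_le_left (γ / 8) (x / 3)], by linarith [min_le_right (γ / 8) (x / 3)]⟩
  obtain ⟨M, hM, hMη, S, hS, hvol, E, hEm, hEt, hEη, hsub⟩ := exists_gridSet_approx hA hAm hη
  obtain ⟨B, hB, hBm, hBvol, hBcorr⟩ := exists_thinned_subset hM hS hp0.le hp1 hη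
  have hB1 : B ⊆ Ico 0 1 := hB.trans (gridSet_subset_Ico hM hS)
  have hAt := volume_ne_top_of_subset_Ico hA
  have h1 : Delta (volume.real B) ≤ p ^ 2 * d + 4 * η := by
    refine delta_le hB1 hBm.nullMeasurableSet fun s => (hBcorr s).trans ?_
    have h2 : corr (gridSet M S) s ≤ d + 2 * η := by
      linarith [corr_le_add hsub hEm.nullMeasurableSet hAt hEt s, hd s]
    have h3 : p ^ 2 * corr (gridSet M S) s ≤ p ^ 2 * (d + 2 * η) := by gcongr
    have h4 : p ^ 2 ≤ 1 := pow_le_one₀ hp0.le hp1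
    nlinarith
  have hle : x - 2 * η ≤ volume.real B := by nlinarith
  have hx1 : x ≤ 1 := by
    have := measureReal_le_of_subset_Ico hA
    rw [hxA]
    exact mul_le_one₀ hp1 measureReal_nonneg this
  have h2 := delta_mono (by linarith) hle (measureReal_le_of_subset_Ico hB1)
  have h3 := delta_le_add (y := x - 2 * η) (by linarith) (by linarith) hx1
  linarith

theorem delta_div_sq_le {x y : ℝ} (hx : 0 < x) (hxy : x ≤ y) (hy : y ≤ 1) :
    Delta x / x ^ 2 ≤ Delta y / y ^ 2 := by
  have hy0 : 0 < y := hx.trans_le hxy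
  have key : Delta x / (x / y) ^ 2 ≤ Delta y := by
    refine le_of_forall_lt fun d hd => ?_
    obtain ⟨d', hd', hd''⟩ := exists_between hd
    refine hd'.trans_le (le_delta hy0 hy fun A hA hAm hAy => ?_)
    -- If every correlation of `A` were below `d'`, thinning by `x / y` would give `Delta x ≤ (x /
    -- y) ^ 2 * d'`.
    by_contra! h
    have := delta_le_mul_of_forall_corr_le (p := x / y) (x := x) (by positivity)
      ((div_le_one hy0).2 hxy) hA hAm hx (by rw [hAy]; field_simp) fun s => (h s).le
    rw [lt_div_iff₀ (by positivity)] at hd''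
    linarith
  rw [div_le_iff₀ (by positivity)]
  rw [div_le_iff₀ (by positivity)] at key
  refine key.trans_eq ?_
  field_simp

theorem abs_delta_sub_le {x y : ℝ} (hx : x ∈ Ioc (0 : ℝ) 1) (hy : y ∈ Ioc (0 : ℝ) 1) :
    |Delta x - Delta y| ≤ 2 * |x - y| := by
  wlog h : y ≤ x generalizing x y
  · rw [abs_sub_comm, abs_sub_comm x]
    exact this hy hx (le_of_not_ge h)
  rw [abs_of_nonneg (sub_nonneg.2 (delta_mono hy.1 h hx.2)), abs_of_nonneg (sub_nonneg.2 h)]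
  linarith [delta_le_add hy.1 h hx.2]

theorem monotoneOn_delta_div_sq : MonotoneOn (fun ε : ℝ => Delta ε / ε ^ 2) (Ioc 0 1) :=
  fun _ hx _ hy hxy => delta_div_sq_le hx.1 hxy hy.2

theorem continuousOn_delta : ContinuousOn Delta (Ioc 0 1) := by
  refine (LipschitzOnWith.of_dist_le_mul (K := 2) fun x hx y hy => ?_).continuousOn
  simpa [Real.dist_eq] using abs_delta_sub_le hx hy

end ContinuousRamsey

theorem theorem1 :
    ContinuousOn ContinuousRamsey.Delta (Ioc 0 1) ∧
    (∀ x ∈ Ioc (0 : ℝ) 1, ∀ y ∈ Ioc (0 : ℝ) 1,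
      |ContinuousRamsey.Delta x - ContinuousRamsey.Delta y| ≤ 2 * |x - y|) ∧
    MonotoneOn (fun ε : ℝ => ContinuousRamsey.Delta ε / ε ^ 2) (Ioc 0 1) ∧
    ∃ L : ℝ, Tendsto (fun ε : ℝ => ContinuousRamsey.Delta ε / ε ^ 2) (𝓝[>] 0) (𝓝 L) := by
  refine ⟨ContinuousRamsey.continuousOn_delta,
    fun x hx y hy => ContinuousRamsey.abs_delta_sub_le hx hy,
    ContinuousRamsey.monotoneOn_delta_div_sq, _,
    (ContinuousRamsey.monotoneOn_delta_div_sq.mono Ioo_subset_Ioc_self).tendsto_nhdsWithin_Ioo_right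
      (nonempty_Ioo.2 one_pos) ⟨0, ?_⟩⟩
  rintro _ ⟨ε, hε, rfl⟩
  exact div_nonneg (ContinuousRamsey.delta_nonneg hε.1 hε.2.le) (sq_nonneg ε)
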